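/- For a real random variable $Y$ write $M(Y) = \sup_{x \in \mathbb{R}} \mathbb{P}(Y = x)$. Let $n \geq 1$ and let $X_1, \dots, X_n$ be independent random variables such that, for each $i \in \{1, \dots, n\}$, $X_i$ takes values in $\{x_i, y_i\}$ almost surely, where $x_i, y_i \in \mathbb{Z}$ with $x_i \leq y_i$, and $$ \mathbb{P}(X_i = x_i) = 1 - \theta_i, \qquad \mathbb{P}(X_i = y_i) = \theta_i, \qquad \theta_i \in (0,1) $$ (so that necessarily $x_i < y_i$). Then $$ \sup_{a \in (\mathbb{R} \setminus \{0\})^n} M(a_1 X_1 + \cdots + a_n X_n) \leq \frac{1}{\sqrt{1 + 2\sum_{i=1}^n \frac{\mathrm{Var}(X_i)}{(x_i - y_i)^2}}}. $$ -/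

import Mathlib

open MeasureTheory ProbabilityTheory

/-- `M(Y) = sup_{x ∈ ℝ} ℙ(Y = x)`, the maximal atom of a real random variable `Y`. -/
noncomputable def maxAtom {Ω : Type*} [MeasurableSpace Ω] (μ : Measure Ω) (Y : Ω → ℝ) : ℝ :=
  ⨆ x : ℝ, μ.real {ω | Y ω = x}

/-- The supremum in `maxAtom` is over a bounded set, so it is a genuine supremum. -/
theorem maxAtom_bddAbove {Ω : Type*} [MeasurableSpace Ω] (μ : Measure Ω)
    [IsProbabilityMeasure μ] (Y : Ω → ℝ) :
    BddAbove (Set.range fun x : ℝ => μ.real {ω | Y ω = x}) :=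
  ⟨1, by rintro _ ⟨x, rfl⟩; exact measureReal_le_one⟩

/-- `M(Y) ≤ 1`; in particular every supremum of values of `maxAtom` is a genuine supremum. -/
theorem maxAtom_le_one {Ω : Type*} [MeasurableSpace Ω] (μ : Measure Ω)
    [IsProbabilityMeasure μ] (Y : Ω → ℝ) : maxAtom μ Y ≤ 1 :=
  ciSup_le fun _ => measureReal_le_one

/-!
The bound is proved by Fourier analysis. Put `S = ∑ i, a i * X i`, `v i = θ i * (1 - θ i)` (which is
`Var (X i) / (x i - y i) ^ 2`) and `σ = ∑ i, v i`. Every atom of the law of `S` is at most the upper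
mean, over `[-r, r]` as `r → ∞`, of the modulus of the characteristic function of `S`
(`measureReal_singleton_le_of_integral_norm_charFun_le`).

By independence this modulus is the product of the moduli for the individual terms. For the `i`-th
one, the square is `1 - 2 * v i * (1 - cos (c i * t))` with `c i = (y i - x i) * a i ≠ 0`, so the
modulus is at most `exp (-(v i * (1 - cos (c i * t))))` (`norm_charFun_two_valued_le`). Jensen's
inequality with weights `v i / σ` and the bound `exp (-s) ≤ (1 + s)⁻¹` then give

  `|φ_S t| ≤ ∑ i, v i / σ * (1 + σ * (1 - cos (c i * t)))⁻¹` (`prod_exp_neg_le_sum`).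

The frequencies `c i` no longer matter: each term on the right is a rescaling of one periodic
function, and has the same mean. That function is a multiple of the Poisson kernel, and its mean over
a period is exactly `1 / √(1 + 2 * σ)` (`integral_inv_one_add_mul_one_sub_cos`).
-/

open Filter Topology Real

/-! ### Fourier inversion for atoms -/

/-- As `r → ∞`, `sinc (r * ·)` converges boundedly to the indicator of `0`, so its integral picks out
the atom at `0`. -/
theorem tendsto_integral_sinc_mul (ν : Measure ℝ) [IsFiniteMeasure ν] :
    Tendsto (fun r : ℝ => ∫ x, sinc (r * x) ∂ν) atTop (𝓝 (ν.real {0})) := by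
  rw [← integral_indicator_one (measurableSet_singleton (0 : ℝ))]
  refine tendsto_integral_filter_of_dominated_convergence (fun _ => 1) ?_ ?_
    (integrable_const _) ?_
  · exact .of_forall fun r => (continuous_sinc.comp (by fun_prop)).aestronglyMeasurable
  · exact .of_forall fun r => .of_forall fun x => abs_sinc_le_one _
  · refine .of_forall fun x => ?_
    by_cases hx : x = 0
    · simp [hx]
    · have hbound : ∀ᶠ r : ℝ in atTop, ‖sinc (r * x)‖ ≤ r⁻¹ * |x|⁻¹ := by
        filter_upwards [eventually_gt_atTop 0] with r hr
        rw [sinc_of_ne_zero (mul_ne_zero hr.ne' hx), norm_div, Real.norm_eq_abs, Real.norm_eq_abs,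
          abs_mul, abs_of_pos hr, ← mul_inv, div_eq_mul_inv]
        exact mul_le_of_le_one_left (by positivity) (abs_sin_le_one _)
      rw [Set.indicator_of_notMem (by simpa using hx)]
      refine squeeze_zero_norm' hbound ?_
      simpa using tendsto_inv_atTop_zero.mul_const (|x|⁻¹)

/-- An upper bound for the mean of the modulus of the characteristic function bounds every atom. -/
theorem measureReal_singleton_le_of_integral_norm_charFun_le (ν : Measure ℝ)
    [IsProbabilityMeasure ν] {C K : ℝ}
    (h : ∀ r : ℝ, 0 < r → ∫ t in -r..r, ‖charFun ν t‖ ≤ C + 2 * r * K) (s : ℝ) :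
    ν.real {s} ≤ K := by
  set ν' := ν.map (fun x => x + -s) with hν'
  have hmeas : Measurable fun x : ℝ => x + -s := by fun_prop
  have : IsProbabilityMeasure ν' := Measure.isProbabilityMeasure_map hmeas.aemeasurable
  have hatom : ν'.real {0} = ν.real {s} := by
    rw [hν', map_measureReal_apply hmeas (measurableSet_singleton 0)]
    congr 1
    ext x
    simp
  rw [← hatom]
  have hnorm (t : ℝ) : ‖charFun ν' t‖ = ‖charFun ν t‖ := by
    rw [hν', charFun_map_add_const, norm_mul, Complex.norm_exp_ofReal_mul_I, mul_one]
  have hlim : Tendsto (fun r : ℝ => C / 2 * r⁻¹ + K) atTop (𝓝 K) := by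
    simpa using (tendsto_inv_atTop_zero.const_mul (C / 2)).add_const K
  refine le_of_tendsto_of_tendsto (tendsto_integral_sinc_mul ν') hlim ?_
  filter_upwards [eventually_gt_atTop 0] with r hr
  have h1 : 2 * r * ∫ x, sinc (r * x) ∂ν' ≤ C + 2 * r * K := by
    calc 2 * r * ∫ x, sinc (r * x) ∂ν' ≤ ‖((2 * r * ∫ x, sinc (r * x) ∂ν' : ℝ) : ℂ)‖ := by
          rw [Complex.norm_real]; exact le_norm_self _
      _ = ‖∫ t in -r..r, charFun ν' t‖ := by
          rw [integral_charFun_Icc hr]; push_cast; rfl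
      _ ≤ ∫ t in -r..r, ‖charFun ν' t‖ :=
          intervalIntegral.norm_integral_le_integral_norm (by linarith)
      _ ≤ C + 2 * r * K := by simpa only [hnorm] using h r hr
  have h2 : 2 * r * (C / 2 * r⁻¹ + K) = C + 2 * r * K := by field_simp
  exact le_of_mul_le_mul_left (h2 ▸ h1) (by linarith)

/-! ### The Poisson kernel -/

/-- With `s = √(1 + 2 * x)` and `ρ = (s - 1) / (s + 1)`, the integrand is `s⁻¹` times the Poisson
kernel of the unit disc at `ρ`, whose circle average is `1`. -/
theorem integral_inv_one_add_mul_one_sub_cos {x : ℝ} (hx : 0 ≤ x) :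
    ∫ u in 0..2 * π, (1 + x * (1 - cos u))⁻¹ = 2 * π * (1 / √(1 + 2 * x)) := by
  set s := √(1 + 2 * x) with hs
  have hs1 : 1 ≤ s := Real.one_le_sqrt.2 (by linarith)
  have hss : s ^ 2 = 1 + 2 * x := Real.sq_sqrt (by linarith)
  set ρ := (s - 1) / (s + 1) with hρ
  have hρ0 : 0 ≤ ρ := div_nonneg (by linarith) (by linarith)
  have hρ1 : ρ < 1 := by rw [hρ, div_lt_one (by linarith)]; linarith
  have hker (u : ℝ) :
      poissonKernel 0 (ρ : ℂ) (circleMap 0 1 u) = s * (1 + x * (1 - cos u))⁻¹ := by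
    have hnorm : ‖circleMap 0 1 u - (ρ : ℂ)‖ ^ 2 = 1 - 2 * ρ * cos u + ρ ^ 2 := by
      rw [← Complex.normSq_eq_norm_sq, Complex.normSq_apply]
      simp only [circleMap, Complex.ofReal_one, one_mul, zero_add, Complex.sub_re, Complex.sub_im,
        Complex.exp_ofReal_mul_I_re, Complex.exp_ofReal_mul_I_im, Complex.ofReal_re,
        Complex.ofReal_im]
      linear_combination sin_sq_add_cos_sq u
    have hpos : 0 < 1 + x * (1 - cos u) := by
      have := mul_nonneg hx (sub_nonneg.2 (cos_le_one u)); linarith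
    have hden : 1 - 2 * ρ * cos u + ρ ^ 2 = 4 * (1 + x * (1 - cos u)) / (s + 1) ^ 2 := by
      rw [hρ]
      field_simp
      linear_combination (2 - 2 * cos u) * hss
    have hnum : 1 - ρ ^ 2 = 4 * s / (s + 1) ^ 2 := by
      rw [hρ]
      field_simp
      ring
    rw [poissonKernel_def]
    simp only [sub_zero, hnorm, norm_circleMap_zero, abs_one, one_pow, Complex.norm_real,
      Real.norm_eq_abs, sq_abs]
    rw [hden, hnum]
    field_simp
  have h := (InnerProductSpace.harmonicOnNhd_const (s := Metric.closedBall (0 : ℂ) 1)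
    (1 : ℝ)).circleAverage_poissonKernel_smul (w := (ρ : ℂ))
    (by simpa [abs_of_nonneg hρ0] using hρ1)
  simp only [Real.circleAverage_def, Pi.mul_apply, smul_eq_mul, mul_one, hker,
    intervalIntegral.integral_const_mul] at h
  have hspos : 0 < s := by linarith
  field_simp at h ⊢
  linarith

/-! ### Means of periodic functions -/

/-- The mean over `[-r, r]` of a rescaled even periodic function exceeds its mean over a period by
at most `O(1 / r)`. -/
theorem exists_integral_comp_mul_le_of_periodic {g : ℝ → ℝ} (hg : Continuous g) (heven : g.Even)
    (hnonneg : ∀ u, 0 ≤ g u) {T K : ℝ} (hT : 0 < T) (hper : g.Periodic T)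
    (hK : ∫ u in 0..T, g u = T * K) {c : ℝ} (hc : c ≠ 0) :
    ∃ C, ∀ r : ℝ, 0 < r → ∫ t in -r..r, g (c * t) ≤ C + 2 * r * K := by
  set B := sSup ((fun t => ∫ x in 0..t, g x) '' Set.Icc 0 T)
  have hc' : 0 < |c| := abs_pos.2 hc
  have habs (t : ℝ) : g (c * t) = g (|c| * t) := by
    rcases abs_choice c with h | h
    · rw [h]
    · rw [h, neg_mul, heven]
  have hI : 0 ≤ T * K := hK ▸ intervalIntegral.integral_nonneg hT.le fun u _ => hnonneg u
  refine ⟨2 * (|c|⁻¹ * B), fun r hr => ?_⟩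
  have hhalf : ∫ u in 0..|c| * r, g u ≤ B + |c| * r * K := by
    refine (hper.integral_le_sSup_add_zsmul_of_pos (hg.intervalIntegrable _ _) hT _).trans ?_
    gcongr
    rw [hK, zsmul_eq_mul]
    calc (⌊|c| * r / T⌋ : ℝ) * (T * K) ≤ |c| * r / T * (T * K) := by
          gcongr; exact Int.floor_le _
      _ = |c| * r * K := by field_simp
  have hneg : ∫ t in -r..0, g (|c| * t) = ∫ t in 0..r, g (|c| * t) := by
    have := intervalIntegral.integral_comp_neg (a := 0) (b := r) fun t => g (|c| * t)
    simp only [mul_neg, heven _, neg_zero] at this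
    exact this.symm
  have hint (a b : ℝ) : IntervalIntegrable (fun t => g (|c| * t)) volume a b :=
    (hg.comp (continuous_const.mul continuous_id)).intervalIntegrable _ _
  simp only [habs]
  rw [← intervalIntegral.integral_add_adjacent_intervals (hint (-r) 0) (hint 0 r), hneg,
    intervalIntegral.integral_comp_mul_left _ hc'.ne', mul_zero, smul_eq_mul]
  have h := mul_le_mul_of_nonneg_left hhalf (inv_pos.2 hc').le
  have h2 : |c|⁻¹ * (B + |c| * r * K) = |c|⁻¹ * B + r * K := by field_simp
  linarith

/-! ### Two-valued random variables -/

section TwoValued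

variable {Ω : Type*} [MeasurableSpace Ω] {μ : Measure Ω} [IsProbabilityMeasure μ]
  {X : Ω → ℤ} {x y : ℤ} {θ : ℝ}

/-- If `x = y`, the event `X = x` has probability `1`, which forces `θ = 0`. -/
theorem ne_of_two_valued (hθ : θ ∈ Set.Ioo (0 : ℝ) 1) (hsupp : ∀ᵐ ω ∂μ, X ω = x ∨ X ω = y)
    (hPx : μ.real {ω | X ω = x} = 1 - θ) : x ≠ y := by
  rintro rfl
  have h : μ {ω | X ω = x} = 1 := by
    rw [← measure_univ (μ := μ)]
    refine measure_congr ?_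
    filter_upwards [hsupp] with ω hω
    exact propext (iff_of_true (or_self_iff.1 hω) trivial)
  rw [measureReal_def, h, ENNReal.toReal_one] at hPx
  linarith [hθ.1]

theorem integral_comp_two_valued {E : Type*} [NormedAddCommGroup E] [NormedSpace ℝ E]
    [CompleteSpace E] (hX : Measurable X) (hxy : x ≠ y)
    (hsupp : ∀ᵐ ω ∂μ, X ω = x ∨ X ω = y) (hPx : μ.real {ω | X ω = x} = 1 - θ)
    (hPy : μ.real {ω | X ω = y} = θ) (f : ℤ → E) :
    ∫ ω, f (X ω) ∂μ = (1 - θ) • f x + θ • f y := by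
  have hm (z : ℤ) : MeasurableSet {ω | X ω = z} := hX (measurableSet_singleton z)
  have hae : (fun ω => f (X ω)) =ᵐ[μ] fun ω =>
      {ω | X ω = x}.indicator (fun _ => f x) ω + {ω | X ω = y}.indicator (fun _ => f y) ω := by
    filter_upwards [hsupp] with ω hω
    rcases hω with h | h
    · simp [h, hxy]
    · simp [h, hxy.symm]
  rw [integral_congr_ae hae, integral_add ((integrable_const _).indicator (hm x))
    ((integrable_const _).indicator (hm y)), integral_indicator_const _ (hm x),
    integral_indicator_const _ (hm y), hPx, hPy]

theorem variance_two_valued (hX : Measurable X) (hxy : x ≠ y)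
    (hsupp : ∀ᵐ ω ∂μ, X ω = x ∨ X ω = y) (hPx : μ.real {ω | X ω = x} = 1 - θ)
    (hPy : μ.real {ω | X ω = y} = θ) :
    variance (fun ω => (X ω : ℝ)) μ = θ * (1 - θ) * ((x : ℝ) - y) ^ 2 := by
  have hm : Measurable fun ω => (X ω : ℝ) := measurable_from_top.comp hX
  rw [variance_eq_integral hm.aemeasurable,
    integral_comp_two_valued hX hxy hsupp hPx hPy fun z => (z : ℝ),
    integral_comp_two_valued hX hxy hsupp hPx hPy
      fun z => ((z : ℝ) - ((1 - θ) • (x : ℝ) + θ • (y : ℝ))) ^ 2]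
  simp only [smul_eq_mul]
  ring

/-- The squared modulus is `1 - 2 * v * (1 - cos ((y - x) * t))` with `v = θ * (1 - θ)`. -/
theorem norm_charFun_two_valued_le (hX : Measurable X) (hxy : x ≠ y)
    (hsupp : ∀ᵐ ω ∂μ, X ω = x ∨ X ω = y) (hPx : μ.real {ω | X ω = x} = 1 - θ)
    (hPy : μ.real {ω | X ω = y} = θ) (t : ℝ) :
    ‖charFun (μ.map fun ω => (X ω : ℝ)) t‖ ≤
      exp (-(θ * (1 - θ) * (1 - cos (((y : ℝ) - x) * t)))) := by
  have hm : Measurable fun ω => (X ω : ℝ) := measurable_from_top.comp hX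
  have hval : charFun (μ.map fun ω => (X ω : ℝ)) t =
      (1 - θ) • Complex.exp ((t * x : ℝ) * Complex.I) +
        θ • Complex.exp ((t * y : ℝ) * Complex.I) := by
    rw [charFun_apply_real, integral_map hm.aemeasurable (by fun_prop),
      integral_comp_two_valued hX hxy hsupp hPx hPy
        fun z => Complex.exp (t * ((z : ℝ) : ℂ) * Complex.I)]
    push_cast
    rfl
  have hsq : ‖charFun (μ.map fun ω => (X ω : ℝ)) t‖ ^ 2 =
      1 - 2 * (θ * (1 - θ)) * (1 - cos (((y : ℝ) - x) * t)) := by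
    rw [hval, ← Complex.normSq_eq_norm_sq, Complex.normSq_apply]
    simp only [Complex.add_re, Complex.add_im, Complex.smul_re, Complex.smul_im,
      Complex.exp_ofReal_mul_I_re, Complex.exp_ofReal_mul_I_im, smul_eq_mul]
    rw [show ((y : ℝ) - x) * t = t * y - t * x by ring, cos_sub]
    linear_combination (1 - θ) ^ 2 * sin_sq_add_cos_sq (t * x) + θ ^ 2 * sin_sq_add_cos_sq (t * y)
  refine (sq_le_sq₀ (norm_nonneg _) (exp_pos _).le).1 ?_
  rw [hsq, ← exp_nat_mul]
  refine le_trans (le_of_eq ?_) (add_one_le_exp _)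
  push_cast
  ring

end TwoValued

/-! ### The concentration bound -/

/-- Jensen's inequality for `exp` with weights `v i / σ`, where `σ = ∑ i, v i`, followed by
`exp (-s) ≤ (1 + s)⁻¹`. -/
theorem prod_exp_neg_le_sum {ι : Type*} [Fintype ι] {v s : ι → ℝ} (hv : ∀ i, 0 ≤ v i)
    (hs : ∀ i, 0 ≤ s i) (hpos : 0 < ∑ i, v i) :
    ∏ i, exp (-(v i * s i)) ≤ ∑ i, v i / (∑ j, v j) * (1 + (∑ j, v j) * s i)⁻¹ := by
  set σ := ∑ j, v j with hσ
  have hw : ∑ i, v i / σ = 1 := by rw [← Finset.sum_div, ← hσ, div_self hpos.ne']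
  have hjensen := convexOn_exp.map_sum_le (t := Finset.univ) (w := fun i => v i / σ)
    (p := fun i => -(σ * s i)) (fun i _ => div_nonneg (hv i) hpos.le) hw (fun i _ => Set.mem_univ _)
  simp only [smul_eq_mul] at hjensen
  calc ∏ i, exp (-(v i * s i)) = exp (∑ i, v i / σ * -(σ * s i)) := by
        rw [← exp_sum]
        congr 1
        refine Finset.sum_congr rfl fun i _ => ?_
        field_simp
    _ ≤ ∑ i, v i / σ * exp (-(σ * s i)) := hjensen
    _ ≤ _ := by
        refine Finset.sum_le_sum fun i _ => mul_le_mul_of_nonneg_left ?_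
          (div_nonneg (hv i) hpos.le)
        rw [exp_neg]
        refine inv_anti₀ (by have := mul_nonneg hpos.le (hs i); linarith) ?_
        linarith [add_one_le_exp (σ * s i)]

theorem measureReal_sum_mul_eq_le {Ω ι : Type*} [MeasurableSpace Ω] [Fintype ι] [Nonempty ι]
    {μ : Measure Ω} [IsProbabilityMeasure μ] {X : ι → Ω → ℤ} (hX : ∀ i, Measurable (X i))
    (hindep : iIndepFun X μ) {x y : ι → ℤ} {θ : ι → ℝ} (hθ : ∀ i, θ i ∈ Set.Ioo (0 : ℝ) 1)
    (hxy : ∀ i, x i ≠ y i) (hsupp : ∀ i, ∀ᵐ ω ∂μ, X i ω = x i ∨ X i ω = y i)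
    (hPx : ∀ i, μ.real {ω | X i ω = x i} = 1 - θ i)
    (hPy : ∀ i, μ.real {ω | X i ω = y i} = θ i) {a : ι → ℝ} (ha : ∀ i, a i ≠ 0) (s : ℝ) :
    μ.real {ω | ∑ i, a i * (X i ω : ℝ) = s} ≤ 1 / √(1 + 2 * ∑ i, θ i * (1 - θ i)) := by
  have hmX (i : ι) : Measurable fun ω => (X i ω : ℝ) := measurable_from_top.comp (hX i)
  have hmS : Measurable fun ω => ∑ i, a i * (X i ω : ℝ) :=
    Finset.measurable_fun_sum _ fun i _ => (hmX i).const_mul (a i)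
  set ν := μ.map fun ω => ∑ i, a i * (X i ω : ℝ) with hν
  have : IsProbabilityMeasure ν := Measure.isProbabilityMeasure_map hmS.aemeasurable
  have hatom : μ.real {ω | ∑ i, a i * (X i ω : ℝ) = s} = ν.real {s} := by
    rw [hν, map_measureReal_apply hmS (measurableSet_singleton s)]
    rfl
  rw [hatom]
  have hv (i : ι) : 0 < θ i * (1 - θ i) := mul_pos (hθ i).1 (sub_pos.2 (hθ i).2)
  set σ := ∑ i, θ i * (1 - θ i) with hσ
  have hσpos : 0 < σ := Finset.sum_pos (fun i _ => hv i) Finset.univ_nonempty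
  set K := 1 / √(1 + 2 * σ) with hK
  let g : ℝ → ℝ := fun u => (1 + σ * (1 - cos u))⁻¹
  have hgpos (u : ℝ) : 0 < 1 + σ * (1 - cos u) := by
    have := mul_nonneg hσpos.le (sub_nonneg.2 (cos_le_one u)); linarith
  have hgcont : Continuous g :=
    Continuous.inv₀ (by fun_prop) fun u => (hgpos u).ne'
  have hc (i : ι) : ((y i : ℝ) - x i) * a i ≠ 0 :=
    mul_ne_zero (sub_ne_zero.2 (by exact_mod_cast (hxy i).symm)) (ha i)
  have hmean (i : ι) := exists_integral_comp_mul_le_of_periodic (g := g) hgcont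
    (fun u => by simp [g]) (fun u => (inv_pos.2 (hgpos u)).le) two_pi_pos
    (fun u => by simp [g]) (integral_inv_one_add_mul_one_sub_cos hσpos.le) (hc i)
  choose C hC using hmean
  have hchar (t : ℝ) :
      ‖charFun ν t‖ ≤ ∑ i, θ i * (1 - θ i) / σ * g (((y i : ℝ) - x i) * a i * t) := by
    have hind : iIndepFun (fun i ω => a i * (X i ω : ℝ)) μ :=
      hindep.comp (fun i z => a i * (z : ℝ)) fun i => measurable_from_top
    rw [hν, hind.charFun_map_fun_sum_eq_prod fun i => ((hmX i).const_mul (a i)).aemeasurable,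
      Finset.prod_apply, norm_prod]
    calc ∏ i, ‖charFun (μ.map fun ω => a i * (X i ω : ℝ)) t‖
        ≤ ∏ i, exp (-(θ i * (1 - θ i) * (1 - cos (((y i : ℝ) - x i) * a i * t)))) := by
          refine Finset.prod_le_prod (fun i _ => norm_nonneg _) fun i _ => ?_
          rw [charFun_map_mul_comp (hmX i).aemeasurable, mul_assoc _ (a i) t]
          exact norm_charFun_two_valued_le (hX i) (hxy i) (hsupp i) (hPx i) (hPy i) _
      _ ≤ _ := prod_exp_neg_le_sum (fun i => (hv i).le)
          (fun i => sub_nonneg.2 (cos_le_one _)) hσpos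
  have hint (r : ℝ) (i : ι) : IntervalIntegrable
      (fun t => θ i * (1 - θ i) / σ * g (((y i : ℝ) - x i) * a i * t)) volume (-r) r := by
    have : Continuous fun t => θ i * (1 - θ i) / σ * g (((y i : ℝ) - x i) * a i * t) :=
      continuous_const.mul (hgcont.comp (continuous_const.mul continuous_id))
    exact this.intervalIntegrable _ _
  refine measureReal_singleton_le_of_integral_norm_charFun_le ν
    (C := ∑ i, θ i * (1 - θ i) / σ * C i) (fun r hr => ?_) s
  calc ∫ t in -r..r, ‖charFun ν t‖
      ≤ ∫ t in -r..r, ∑ i, θ i * (1 - θ i) / σ * g (((y i : ℝ) - x i) * a i * t) := by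
        refine intervalIntegral.integral_mono (by linarith)
          (continuous_charFun.norm.intervalIntegrable _ _)
          ?_ hchar
        simpa only [Finset.sum_fn] using IntervalIntegrable.sum Finset.univ fun i _ => hint r i
    _ = ∑ i, θ i * (1 - θ i) / σ * ∫ t in -r..r, g (((y i : ℝ) - x i) * a i * t) := by
        rw [intervalIntegral.integral_finsetSum fun i _ => hint r i]
        simp only [intervalIntegral.integral_const_mul]
    _ ≤ ∑ i, θ i * (1 - θ i) / σ * (C i + 2 * r * K) := by
        refine Finset.sum_le_sum fun i _ => mul_le_mul_of_nonneg_left (hC i r hr)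
          (div_nonneg (hv i).le hσpos.le)
    _ = ∑ i, θ i * (1 - θ i) / σ * C i + 2 * r * K := by
        have hw : ∑ i, θ i * (1 - θ i) / σ = 1 := by
          rw [← Finset.sum_div, ← hσ, div_self hσpos.ne']
        simp only [mul_add, Finset.sum_add_distrib]
        rw [← Finset.sum_mul, hw, one_mul]

theorem mainTheorem6 {Ω : Type*} [MeasurableSpace Ω] (μ : Measure Ω) [IsProbabilityMeasure μ]
    (n : ℕ) (X : Fin n → Ω → ℤ) (hX : ∀ i, Measurable (X i)) (hindep : iIndepFun X μ)
    (x y : Fin n → ℤ) (hxy : ∀ i, x i ≤ y i)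
    (θ : Fin n → ℝ) (hθ : ∀ i, θ i ∈ Set.Ioo (0 : ℝ) 1)
    (hsupp : ∀ i, ∀ᵐ ω ∂μ, X i ω = x i ∨ X i ω = y i)
    (hPx : ∀ i, μ.real {ω | X i ω = x i} = 1 - θ i)
    (hPy : ∀ i, μ.real {ω | X i ω = y i} = θ i) :
    (⨆ a : {a : Fin n → ℝ // ∀ i, a i ≠ 0}, maxAtom μ (fun ω => ∑ i, a.1 i * (X i ω : ℝ))) ≤
      1 / √(1 + 2 * ∑ i, variance (fun ω => (X i ω : ℝ)) μ / ((x i : ℝ) - (y i : ℝ)) ^ 2) := by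
  have hne (i : Fin n) : x i ≠ y i := ne_of_two_valued (hθ i) (hsupp i) (hPx i)
  have hvar (i : Fin n) :
      variance (fun ω => (X i ω : ℝ)) μ / ((x i : ℝ) - (y i : ℝ)) ^ 2 = θ i * (1 - θ i) := by
    have hd : (x i : ℝ) - y i ≠ 0 := sub_ne_zero.2 (by exact_mod_cast hne i)
    rw [variance_two_valued (hX i) (hne i) (hsupp i) (hPx i) (hPy i),
      mul_div_cancel_right₀ _ (pow_ne_zero 2 hd)]
  simp only [hvar]
  have : Nonempty {a : Fin n → ℝ // ∀ i, a i ≠ 0} := ⟨⟨fun _ => 1, fun _ => one_ne_zero⟩⟩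
  refine ciSup_le fun a => ?_
  -- The Jensen weights need a positive total variance, so the empty sum is treated separately.
  rcases isEmpty_or_nonempty (Fin n) with hn | hn
  · simpa using maxAtom_le_one μ fun ω => ∑ i, a.1 i * (X i ω : ℝ)
  · exact ciSup_le fun s =>
      measureReal_sum_mul_eq_le hX hindep hθ hne hsupp hPx hPy a.2 s
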